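/- Let $(\omega_x)_{x\in\mathbb Z^2}$ be independent, rate $1$ exponentially distributed random variables on a probability space. For $x,y\in\mathbb Z^2$ with $x\le y$ coordinatewise, let $\Pi_{x,y}$ be the set of up-right paths $x_\bullet=(x_k)_{k=0}^{n}$ in $\mathbb Z^2$ with $x_0=x$, $x_n=y$, $n=|y-x|_1$ and increments $x_{k+1}-x_k\in\{(1,0),(0,1)\}$, and let $$G_{x,y}=\max_{x_\bullet\in\Pi_{x,y}}\ \sum_{k=0}^{|y-x|_1}\omega_{x_k}$$ be the point-to-point last-passage value (with $G_{x,y}=-\infty$ if $x\le y$ fails). Write $\lfloor v\rfloor=(\lfloor v_1\rfloor,\lfloor v_2\rfloor)$ for $v\in\mathbb R^2$. Then for each $\xi=(\xi_1,\xi_2)\in\mathbb R_{\ge0}^2$, with probability $1$, $$\lim_{N\to\infty}N^{-1}\,G_{0,\lfloor N\xi\rfloor}=\bigl(\sqrt{\xi_1}+\sqrt{\xi_2}\,\bigr)^2 .$$ -/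

import Mathlib

open MeasureTheory ProbabilityTheory Filter
open scoped Topology

/-- The `ℓ¹`-distance `|y - x|₁` of two points of the lattice `ℤ²`. -/
def latticeDist (x y : ℤ × ℤ) : ℕ :=
  (y.1 - x.1).natAbs + (y.2 - x.2).natAbs

/-- The set `Π_{x,y}` of up-right paths `x_0, …, x_n` with `x_0 = x`, `x_n = y`, `n = |y - x|₁`
and increments in `{e₁, e₂}`. It is empty unless `x ≤ y` coordinatewise. -/
def upRightPaths (x y : ℤ × ℤ) : Set (Fin (latticeDist x y + 1) → ℤ × ℤ) :=
  {p | p 0 = x ∧ p (Fin.last (latticeDist x y)) = y ∧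
    ∀ k : Fin (latticeDist x y),
      p k.succ - p k.castSucc = (1, 0) ∨ p k.succ - p k.castSucc = (0, 1)}

/-- The last-passage value `G_{x,y}` for the vertex weights `w`: the maximum over `Π_{x,y}` of the
total weight of the path, both endpoints included. It takes values in the extended reals, because
it is `-∞` (the supremum of the empty set) when `x ≤ y` fails. -/
noncomputable def lastPassage (w : ℤ × ℤ → ℝ) (x y : ℤ × ℤ) : EReal :=
  ⨆ p ∈ upRightPaths x y, ((∑ k, w (p k) : ℝ) : EReal)

/-- The integer part of a point of the plane, taken coordinatewise. -/
noncomputable def floorPoint (v : ℝ × ℝ) : ℤ × ℤ := (⌊v.1⌋, ⌊v.2⌋)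

/-! Add exponential increments of rates `r` and `s`, with `r + s = 1`, along the two axes of the
quadrant. Burke's theorem makes this boundary model stationary: the increments along every
horizontal line are again independent of rate `r`. Going up the left side and then along the top,
its passage time to `N(x, y)` therefore grows like `N(x/r + y/s)` (`tendsto_fieldGrowth`).
Nonnegative boundary weights only help, so `x/r + y/s` bounds the original limit from above, and its
infimum over `r` is `(√x + √y)²`. For the lower bound take `r` optimal. If the maximal path followed
an axis for longer than `εN`, then raising the boundary weights on that axis (rate `r' < r`) would
gain at least `ε(1/r' - 1/r)N`, which is of first order in `r - r'`. The constant `x/r + y/s` is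
stationary at the optimum and moves only to second order, so this is impossible. The path thus
leaves the boundary within `εN` of the corner, and deleting the boundary costs `O(εN)`
(`growth_trichotomy`, `exists_rate_perturbation`). Finally, for nonnegative weights the recursion
computes the maximum over paths (`lastPassage_eq_rectanglePassage`). -/

/-! ### Burke's theorem for one cell -/

/-- The local update of a horizontal increment, a vertical increment and a weight across one cell. -/
noncomputable def burkeMap (p : ℝ × ℝ × ℝ) : ℝ × ℝ × ℝ :=
  (p.2.2 + max (p.1 - p.2.1) 0, p.2.2 + max (p.2.1 - p.1) 0, min p.1 p.2.1)

lemma measurable_burkeMap : Measurable burkeMap := by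
  unfold burkeMap; fun_prop

lemma measurePreserving_shear_fst {f : ℝ × ℝ → ℝ} (hf : Measurable f) :
    MeasurePreserving (fun p : ℝ × ℝ × ℝ => (p.1 + f p.2, p.2)) volume volume := by
  have h : MeasurePreserving (fun p : (ℝ × ℝ) × ℝ => (p.1, p.2 + f p.1))
      ((volume : Measure (ℝ × ℝ)).prod (volume : Measure ℝ))
      ((volume : Measure (ℝ × ℝ)).prod (volume : Measure ℝ)) :=
    (MeasurePreserving.id (volume : Measure (ℝ × ℝ))).skew_product
      (g := fun c x => x + f c) (by fun_prop)
      (Eventually.of_forall fun c => (measurePreserving_add_right volume (f c)).map_eq)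
  exact (Measure.measurePreserving_swap.comp h).comp
    (Measure.measurePreserving_swap (μ := (volume : Measure ℝ)) (ν := (volume : Measure (ℝ × ℝ))))

lemma measurePreserving_shear_snd {f : ℝ → ℝ} (hf : Measurable f) :
    MeasurePreserving (fun p : ℝ × ℝ × ℝ => (p.1, p.2.1 + f p.1, p.2.2)) volume volume :=
  (MeasurePreserving.id (volume : Measure ℝ)).skew_product
    (g := fun (c : ℝ) (x : ℝ × ℝ) => (x.1 + f c, x.2)) (by fun_prop)
    (Eventually.of_forall fun c =>
      ((measurePreserving_add_right volume (f c)).prod (MeasurePreserving.id volume)).map_eq)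

/-- The map is a composition of shears and a swap: pass to `d = x - y`, turn `y` into `min x y`,
exchange it with `z`, then undo the two shears. -/
lemma measurePreserving_burkeMap_volume : MeasurePreserving burkeMap volume volume := by
  have h1 := measurePreserving_shear_fst (f := fun p => -p.1) (by fun_prop)
  have h2 := measurePreserving_shear_snd (f := fun d => min d 0) (by fun_prop)
  have h3 : MeasurePreserving (Prod.map id Prod.swap : ℝ × ℝ × ℝ → ℝ × ℝ × ℝ) volume volume :=
    (MeasurePreserving.id (volume : Measure ℝ)).prod
      (Measure.measurePreserving_swap (μ := (volume : Measure ℝ)) (ν := (volume : Measure ℝ)))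
  have h4 := measurePreserving_shear_snd (f := fun d => -min d 0) (by fun_prop)
  have h5 := measurePreserving_shear_fst (f := fun p => p.1) (by fun_prop)
  convert! h5.comp (h4.comp (h3.comp (h2.comp h1))) using 1
  funext ⟨x, y, z⟩
  simp only [burkeMap, Function.comp, Prod.map, id, Prod.swap, Prod.mk.injEq]
  rcases le_total x y with h | h
  · rw [max_eq_right (by linarith), max_eq_left (by linarith), min_eq_left h,
      min_eq_left (by linarith)]

    refine ⟨by linarith, by linarith, by linarith⟩
  · rw [max_eq_left (by linarith), max_eq_right (by linarith), min_eq_right h,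
      min_eq_right (by linarith)]
    refine ⟨by linarith, by linarith, by linarith⟩

lemma expMeasure_eq_withDensity (r : ℝ) :
    expMeasure r = volume.withDensity (exponentialPDF r) := rfl

lemma measurable_exponentialPDF (r : ℝ) : Measurable (exponentialPDF r) :=
  (measurable_exponentialPDFReal r).ennreal_ofReal

/-- The joint density depends only on `r x + s y + z` and on the positivity of the coordinates. The
map preserves both; the linear form is conserved precisely because `r + s = 1`. -/
lemma exponentialPDF_burkeMap {r s : ℝ} (hr : 0 < r) (hs : 0 < s) (hrs : r + s = 1)
    (p : ℝ × ℝ × ℝ) :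
    exponentialPDF r (burkeMap p).1 * (exponentialPDF s (burkeMap p).2.1 *
      exponentialPDF 1 (burkeMap p).2.2) =
    exponentialPDF r p.1 * (exponentialPDF s p.2.1 * exponentialPDF 1 p.2.2) := by
  obtain ⟨x, y, z⟩ := p
  simp only [burkeMap]
  have key : ∀ x' y' z' : ℝ, r * x' + s * y' + z' = r * x + s * y + z →
      ((0 ≤ x' ∧ 0 ≤ y' ∧ 0 ≤ z') ↔ (0 ≤ x ∧ 0 ≤ y ∧ 0 ≤ z)) →
      exponentialPDF r x' * (exponentialPDF s y' * exponentialPDF 1 z') =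
        exponentialPDF r x * (exponentialPDF s y * exponentialPDF 1 z) := by
    intro x' y' z' h1 h2
    have aux : ∀ x y z : ℝ, exponentialPDF r x * (exponentialPDF s y * exponentialPDF 1 z) =
        if 0 ≤ x ∧ 0 ≤ y ∧ 0 ≤ z then ENNReal.ofReal (r * s * Real.exp (-(r * x + s * y + z)))
        else 0 := by
      intro x y z
      split_ifs with h
      · obtain ⟨hx, hy, hz⟩ := h
        rw [exponentialPDF_of_nonneg hx, exponentialPDF_of_nonneg hy, exponentialPDF_of_nonneg hz,
          ← ENNReal.ofReal_mul (by positivity), ← ENNReal.ofReal_mul (by positivity)]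
        congr 1
        rw [neg_add, neg_add, Real.exp_add, Real.exp_add, one_mul z]
        ring
      · by_cases hx : 0 ≤ x
        · by_cases hy : 0 ≤ y
          · have hz : z < 0 := by
              by_contra hz
              exact h ⟨hx, hy, not_lt.1 hz⟩
            rw [exponentialPDF_of_neg hz]; simp
          · rw [exponentialPDF_of_neg (not_le.1 hy)]; simp
        · rw [exponentialPDF_of_neg (not_le.1 hx)]; simp
    rw [aux, aux, h1]
    simp only [h2]
  have hs' : s = 1 - r := by linarith
  subst hs'
  apply key
  · rcases le_total x y with h | h
    · rw [max_eq_right (by linarith), max_eq_left (by linarith), min_eq_left h]; ring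
    · rw [max_eq_left (by linarith), max_eq_right (by linarith), min_eq_right h]; ring
  · rcases le_total x y with h | h
    · rw [max_eq_right (by linarith), max_eq_left (by linarith), min_eq_left h]
      constructor
      · rintro ⟨h1, h2, h3⟩; refine ⟨?_, ?_, ?_⟩ <;> linarith
      · rintro ⟨h1, h2, h3⟩; refine ⟨?_, ?_, ?_⟩ <;> linarith
    · rw [max_eq_left (by linarith), max_eq_right (by linarith), min_eq_right h]
      constructor
      · rintro ⟨h1, h2, h3⟩; refine ⟨?_, ?_, ?_⟩ <;> linarith
      · rintro ⟨h1, h2, h3⟩; refine ⟨?_, ?_, ?_⟩ <;> linarith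

/-- The local form of Burke's theorem. -/
theorem measurePreserving_burkeMap {r s : ℝ} (hr : 0 < r) (hs : 0 < s) (hrs : r + s = 1) :
    MeasurePreserving burkeMap
      ((expMeasure r).prod ((expMeasure s).prod (expMeasure 1)))
      ((expMeasure r).prod ((expMeasure s).prod (expMeasure 1))) := by
  have := isProbabilityMeasure_expMeasure hr
  have := isProbabilityMeasure_expMeasure hs
  have := isProbabilityMeasure_expMeasure one_pos
  have e : (expMeasure r).prod ((expMeasure s).prod (expMeasure 1)) =
      (volume : Measure (ℝ × ℝ × ℝ)).withDensity (fun p => exponentialPDF r p.1 *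
        (exponentialPDF s p.2.1 * exponentialPDF 1 p.2.2)) := by
    simp only [expMeasure_eq_withDensity] at *
    rw [prod_withDensity (measurable_exponentialPDF s) (measurable_exponentialPDF 1),
      prod_withDensity (measurable_exponentialPDF r)]
    · rfl
    · exact ((measurable_exponentialPDF s).comp measurable_fst).mul
        ((measurable_exponentialPDF 1).comp measurable_snd)
  have hm : Measurable (fun p : ℝ × ℝ × ℝ => exponentialPDF r p.1 *
      (exponentialPDF s p.2.1 * exponentialPDF 1 p.2.2)) :=
    ((measurable_exponentialPDF r).comp measurable_fst).mul
      (((measurable_exponentialPDF s).comp (measurable_fst.comp measurable_snd)).mul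
        ((measurable_exponentialPDF 1).comp (measurable_snd.comp measurable_snd)))
  rw [e]
  refine ⟨measurable_burkeMap, ?_⟩
  ext A hA
  rw [Measure.map_apply measurable_burkeMap hA, withDensity_apply _ hA,
    withDensity_apply _ (measurable_burkeMap hA),
    ← measurePreserving_burkeMap_volume.setLIntegral_comp_preimage hA hm]
  simp only [exponentialPDF_burkeMap hr hs hrs]

/-! ### Independent families under local updates -/

/-- The family `X` is independent and `X z` has the law `μ z`, expressed on cylinder sets. -/
def IndepLaws {Ω ι : Type*} [MeasurableSpace Ω] (P : Measure Ω) (X : ι → Ω → ℝ)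
    (μ : ι → Measure ℝ) : Prop :=
  ∀ (s : Finset ι) (t : ι → Set ℝ), (∀ z, MeasurableSet (t z)) →
    P (⋂ z ∈ s, X z ⁻¹' t z) = ∏ z ∈ s, μ z (t z)

section

variable {Ω ι : Type*} [MeasurableSpace Ω] {P : Measure Ω} {X Y : ι → Ω → ℝ} {μ : ι → Measure ℝ}

lemma IndepLaws.of_iIndepFun (h : iIndepFun X P) (hμ : ∀ z, HasLaw (X z) (μ z) P) :
    IndepLaws P X μ := by
  intro s t ht
  rw [h.measure_inter_preimage_eq_mul s fun z _ => ht z]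
  refine Finset.prod_congr rfl fun z _ => ?_
  rw [← (hμ z).map_eq, Measure.map_apply_of_aemeasurable (hμ z).aemeasurable (ht z)]

lemma IndepLaws.hasLaw (h : IndepLaws P X μ) (hX : ∀ z, Measurable (X z)) (z : ι) :
    HasLaw (X z) (μ z) P := by
  refine ⟨(hX z).aemeasurable, ?_⟩
  ext A hA
  rw [Measure.map_apply (hX z) hA]
  simpa using h {z} (fun _ => A) (fun _ => hA)

lemma IndepLaws.iIndepFun (h : IndepLaws P X μ) (hX : ∀ z, Measurable (X z)) :
    iIndepFun X P := by
  classical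
  rw [iIndepFun_iff_measure_inter_preimage_eq_mul]
  intro s t ht
  have e : ∀ z ∈ s, (if z ∈ s then t z else Set.univ) = t z := fun z hz => if_pos hz
  have h1 := h s (fun z => if z ∈ s then t z else Set.univ) (by
    intro z
    split_ifs with hz
    · exact ht z hz
    · exact MeasurableSet.univ)
  have e2 : (⋂ z ∈ s, X z ⁻¹' (if z ∈ s then t z else Set.univ)) = ⋂ z ∈ s, X z ⁻¹' t z :=
    Set.iInter₂_congr fun z hz => by rw [e z hz]
  rw [e2] at h1
  rw [h1]
  refine Finset.prod_congr rfl fun z hz => ?_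
  rw [e z hz, ← (h.hasLaw hX z).map_eq, Measure.map_apply (hX z) (ht z hz)]

/-- Applying a measure-preserving map to three coordinates of an independent family. -/
theorem IndepLaws.update_three [DecidableEq ι] [∀ z, IsProbabilityMeasure (μ z)]
    [IsProbabilityMeasure P] (h : IndepLaws P X μ)
    (hX : ∀ z, Measurable (X z)) {i j k : ι} (hij : i ≠ j) (hik : i ≠ k) (hjk : j ≠ k)
    {F : ℝ × ℝ × ℝ → ℝ × ℝ × ℝ}
    (hF : MeasurePreserving F ((μ i).prod ((μ j).prod (μ k))) ((μ i).prod ((μ j).prod (μ k))))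
    (hY : ∀ a, (Y i a, Y j a, Y k a) = F (X i a, X j a, X k a))
    (hYX : ∀ z, z ≠ i → z ≠ j → z ≠ k → Y z = X z) :
    IndepLaws P Y μ := by
  intro s t ht
  -- Padding with `Set.univ` outside `s` lets `i`, `j`, `k` be treated as if they belonged to `s`.
  set u : ι → Set ℝ := fun z => if z ∈ s then t z else Set.univ with hu
  have hum : ∀ z, MeasurableSet (u z) := by
    intro z
    simp only [hu]
    split_ifs
    exacts [ht z, MeasurableSet.univ]
  have hus : ∀ z ∈ s, u z = t z := fun z hz => if_pos hz
  have hus' : ∀ z, z ∉ s → u z = Set.univ := fun z hz => if_neg hz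
  set T : Finset ι := s \ {i, j, k} with hT
  set B : Set (ℝ × ℝ × ℝ) := u i ×ˢ (u j ×ˢ u k) with hB
  have hBm : MeasurableSet B := (hum i).prod ((hum j).prod (hum k))
  have hset : (⋂ z ∈ s, Y z ⁻¹' t z) =
      (fun a => (X i a, X j a, X k a)) ⁻¹' (F ⁻¹' B) ∩ ⋂ z ∈ T, X z ⁻¹' t z := by
    ext a
    simp only [Set.mem_iInter, Set.mem_preimage, Set.mem_inter_iff, ← hY, hB, Set.mem_prod]
    constructor
    · intro ha
      have ha' : ∀ z, Y z a ∈ u z := by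
        intro z
        by_cases hz : z ∈ s
        · rw [hus z hz]; exact ha z hz
        · rw [hus' z hz]; trivial
      refine ⟨⟨ha' i, ha' j, ha' k⟩, fun z hz => ?_⟩
      simp only [hT, Finset.mem_sdiff, Finset.mem_insert, Finset.mem_singleton, not_or] at hz
      rw [← hYX z hz.2.1 hz.2.2.1 hz.2.2.2]
      exact ha z hz.1
    · rintro ⟨⟨h1, h2, h3⟩, h4⟩ z hz
      by_cases hzi : z = i
      · subst hzi; rwa [hus z hz] at h1
      by_cases hzj : z = j
      · subst hzj; rwa [hus z hz] at h2
      by_cases hzk : z = k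
      · subst hzk; rwa [hus z hz] at h3
      rw [hYX z hzi hzj hzk]
      exact h4 z (by simp [hT, hz, hzi, hzj, hzk])
  have hind := h.iIndepFun hX
  have hdisj : Disjoint ({i, j, k} : Finset ι) T := by
    rw [hT]; exact Finset.disjoint_sdiff
  have hsplit := hind.indepFun_finset {i, j, k} T hdisj hX
  have htri : P.map (fun a => (X i a, X j a, X k a)) = (μ i).prod ((μ j).prod (μ k)) := by
    have h1 := (indepFun_iff_map_prod_eq_prod_map_map (hX j).aemeasurable
      (hX k).aemeasurable).1 (hind.indepFun hjk)
    have h2 := (hind.indepFun_prodMk hX j k i hij.symm hik.symm).symm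
    have h3 := (indepFun_iff_map_prod_eq_prod_map_map (hX i).aemeasurable
      ((hX j).prodMk (hX k)).aemeasurable).1 h2
    rw [h3, h1, (h.hasLaw hX i).map_eq, (h.hasLaw hX j).map_eq, (h.hasLaw hX k).map_eq]
  have hXm : Measurable (fun a => (X i a, X j a, X k a)) := (hX i).prodMk ((hX j).prodMk (hX k))
  have hprod : P ((fun a => (X i a, X j a, X k a)) ⁻¹' (F ⁻¹' B) ∩ ⋂ z ∈ T, X z ⁻¹' t z) =
      P ((fun a => (X i a, X j a, X k a)) ⁻¹' (F ⁻¹' B)) * P (⋂ z ∈ T, X z ⁻¹' t z) := by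
    have hi : i ∈ ({i, j, k} : Finset ι) := by simp
    have hj : j ∈ ({i, j, k} : Finset ι) := by simp
    have hk : k ∈ ({i, j, k} : Finset ι) := by simp
    have h1 : Measurable (fun f : ({i, j, k} : Finset ι) → ℝ => (f ⟨i, hi⟩, f ⟨j, hj⟩, f ⟨k, hk⟩)) :=
      by fun_prop
    have h2 := hsplit.measure_inter_preimage_eq_mul
      ((fun f : ({i, j, k} : Finset ι) → ℝ => (f ⟨i, hi⟩, f ⟨j, hj⟩, f ⟨k, hk⟩)) ⁻¹' (F ⁻¹' B))
      (⋂ z : T, (fun f : T → ℝ => f z) ⁻¹' t z)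
      (h1 (hF.measurable hBm))
      (MeasurableSet.iInter fun z => measurable_pi_apply z (ht z))
    have e : (fun a (z : T) => X z a) ⁻¹' (⋂ z : T, (fun f : T → ℝ => f z) ⁻¹' t z) =
        ⋂ z ∈ T, X z ⁻¹' t z := by
      ext a; simp
    rw [e] at h2
    exact h2
  rw [hset, hprod, h T t ht, ← Measure.map_apply hXm (hF.measurable hBm), htri,
    hF.measure_preimage hBm.nullMeasurableSet, hB, Measure.prod_prod, Measure.prod_prod]
  have hbig : ∏ z ∈ s, μ z (t z) = ∏ z ∈ s ∪ {i, j, k}, μ z (u z) := by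
    rw [← Finset.prod_subset (Finset.subset_union_left (s₁ := s) (s₂ := {i, j, k}))]
    · exact Finset.prod_congr rfl fun z hz => by rw [hus z hz]
    · intro z _ hz
      rw [hus' z hz, measure_univ]
  have hT' : ∏ z ∈ T, μ z (t z) = ∏ z ∈ T, μ z (u z) :=
    Finset.prod_congr rfl fun z hz => by rw [hus z (Finset.mem_sdiff.1 hz).1]
  rw [hbig, hT', ← Finset.sdiff_union_self_eq_union, Finset.prod_union hdisj.symm, mul_comm, Finset.prod_insert (by simp [hij, hik]), Finset.prod_insert (by simp [hjk]),
    Finset.prod_singleton]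

end

/-! ### The growth recursion and its increments -/

/-- The corner growth recursion with horizontal boundary increments `h`, vertical boundary
increments `v` and bulk weights `w`. -/
noncomputable def growth (h v : ℕ → ℝ) (w : ℕ → ℕ → ℝ) : ℕ → ℕ → ℝ
  | m, 0 => ∑ i ∈ Finset.range m, h i
  | 0, n + 1 => ∑ j ∈ Finset.range (n + 1), v j
  | m + 1, n + 1 => w m n + max (growth h v w m (n + 1)) (growth h v w (m + 1) n)

section

variable (h v : ℕ → ℝ) (w : ℕ → ℕ → ℝ)

lemma growth_zero_right (m : ℕ) : growth h v w m 0 = ∑ i ∈ Finset.range m, h i := by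
  rw [growth.eq_def]

lemma growth_zero_left (n : ℕ) : growth h v w 0 n = ∑ j ∈ Finset.range n, v j := by
  cases n <;> rw [growth.eq_def]
  simp

lemma growth_succ (m n : ℕ) : growth h v w (m + 1) (n + 1) =
    w m n + max (growth h v w m (n + 1)) (growth h v w (m + 1) n) := by
  rw [growth]

/-- The horizontal increment of `growth`. -/
noncomputable def hIncr (m n : ℕ) : ℝ := growth h v w (m + 1) n - growth h v w m n

/-- The vertical increment of `growth`. -/
noncomputable def vIncr (m n : ℕ) : ℝ := growth h v w m (n + 1) - growth h v w m n

lemma incr_eq_burkeMap (m n : ℕ) :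
    (hIncr h v w m (n + 1), vIncr h v w (m + 1) n, min (hIncr h v w m n) (vIncr h v w m n)) =
      burkeMap (hIncr h v w m n, vIncr h v w m n, w m n) := by
  simp only [hIncr, vIncr, burkeMap, growth_succ, Prod.mk.injEq]
  refine ⟨?_, ?_, trivial⟩
  · rcases le_total (growth h v w m (n + 1)) (growth h v w (m + 1) n) with H | H
    · rw [max_eq_right H, max_eq_left (by linarith)]; ring
    · rw [max_eq_left H, max_eq_right (by linarith)]; ring
  · rcases le_total (growth h v w m (n + 1)) (growth h v w (m + 1) n) with H | H
    · rw [max_eq_right H, max_eq_right (by linarith)]; ring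
    · rw [max_eq_left H, max_eq_left (by linarith)]; ring

lemma growth_eq_sum_add_sum (m n : ℕ) : growth h v w m n =
    ∑ j ∈ Finset.range n, v j + ∑ i ∈ Finset.range m, hIncr h v w i n := by
  simp only [hIncr]
  rw [Finset.sum_range_sub (fun i => growth h v w i n), growth_zero_left]
  ring

end

lemma measurable_growth {Ω : Type*} [MeasurableSpace Ω] {h v : ℕ → Ω → ℝ} {w : ℕ → ℕ → Ω → ℝ}
    (hh : ∀ i, Measurable (h i)) (hv : ∀ j, Measurable (v j)) (hw : ∀ i j, Measurable (w i j))
    (m n : ℕ) :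
    Measurable fun a => growth (fun i => h i a) (fun j => v j a) (fun i j => w i j a) m n := by
  induction m generalizing n with
  | zero => simp only [growth_zero_left]; fun_prop
  | succ m ihm =>
    induction n with
    | zero => simp only [growth_zero_right]; fun_prop
    | succ n ihn =>
      simp only [growth_succ]
      exact (hw m n).add ((ihm (n + 1)).max ihn)

/-! ### Burke's theorem along growing diagrams -/

/-- Index set of horizontal boundary increments, vertical boundary increments and bulk weights. -/
abbrev CornerIndex : Type := ℕ ⊕ ℕ ⊕ ℕ × ℕ

/-- `growth` for a field indexed by `CornerIndex`. -/
noncomputable def fieldGrowth (x : CornerIndex → ℝ) : ℕ → ℕ → ℝ :=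
  growth (fun i => x (.inl i)) (fun j => x (.inr (.inl j))) (fun i j => x (.inr (.inr (i, j))))

/-- The field after the cells of a diagram with column heights `a` and row lengths `b` have been
processed: the increments along the boundary of the diagram, the weights outside it, and the dual
weights inside it. -/
noncomputable def diagramField (x : CornerIndex → ℝ) (a b : ℕ → ℕ) : CornerIndex → ℝ
  | .inl i => fieldGrowth x (i + 1) (a i) - fieldGrowth x i (a i)
  | .inr (.inl j) => fieldGrowth x (b j) (j + 1) - fieldGrowth x (b j) j
  | .inr (.inr (i, j)) => if j < a i then
      min (fieldGrowth x (i + 1) j - fieldGrowth x i j) (fieldGrowth x i (j + 1) - fieldGrowth x i j)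
    else x (.inr (.inr (i, j)))

lemma diagramField_zero (x : CornerIndex → ℝ) : diagramField x 0 0 = x := by
  funext z
  rcases z with i | j | ⟨i, j⟩
  · simp [diagramField, fieldGrowth, growth_zero_right, Finset.sum_range_succ]
  · simp [diagramField, fieldGrowth, growth_zero_left, Finset.sum_range_succ]
  · simp [diagramField]

/-- `ha` and `hb` say that `(i, j)` is a corner where a cell can be added. The two boundary
increments next to it and its weight are then replaced through `burkeMap`; nothing else changes. -/
lemma diagramField_add_cell (x : CornerIndex → ℝ) {a b : ℕ → ℕ} {i j : ℕ} (ha : a i = j)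
    (hb : b j = i) :
    (diagramField x (Function.update a i (j + 1)) (Function.update b j (i + 1)) (.inl i),
      diagramField x (Function.update a i (j + 1)) (Function.update b j (i + 1)) (.inr (.inl j)),
      diagramField x (Function.update a i (j + 1)) (Function.update b j (i + 1))
        (.inr (.inr (i, j)))) =
    burkeMap (diagramField x a b (.inl i), diagramField x a b (.inr (.inl j)),
      diagramField x a b (.inr (.inr (i, j)))) := by
  have := incr_eq_burkeMap (fun i => x (.inl i)) (fun j => x (.inr (.inl j)))
    (fun i j => x (.inr (.inr (i, j)))) i j
  simp only [diagramField, Function.update_self, Nat.lt_succ_self, if_true, ha, hb, lt_irrefl,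
    if_false]
  exact this

lemma diagramField_add_cell_of_ne (x : CornerIndex → ℝ) {a b : ℕ → ℕ} {i j : ℕ} (ha : a i = j)
    {z : CornerIndex} (h1 : z ≠ .inl i) (h2 : z ≠ .inr (.inl j)) (h3 : z ≠ .inr (.inr (i, j))) :
    diagramField x (Function.update a i (j + 1)) (Function.update b j (i + 1)) z =
      diagramField x a b z := by
  rcases z with i' | j' | ⟨i', j'⟩
  · have : i' ≠ i := fun e => h1 (by rw [e])
    simp [diagramField, Function.update_of_ne this]
  · have : j' ≠ j := fun e => h2 (by rw [e])
    simp [diagramField, Function.update_of_ne this]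
  · by_cases hi : i' = i
    · subst hi
      have hj : j' ≠ j := fun e => h3 (by rw [e])
      have e : j' < j + 1 ↔ j' < j := by omega
      simp [diagramField, ha, e]
    · simp [diagramField, Function.update_of_ne hi]

/-- The marginal laws of the stationary corner growth model. -/
noncomputable def cornerLaw (r s : ℝ) : CornerIndex → Measure ℝ
  | .inl _ => expMeasure r
  | .inr (.inl _) => expMeasure s
  | .inr (.inr _) => expMeasure 1

section

variable {Ω : Type*} [MeasurableSpace Ω] {P : Measure Ω} {X : CornerIndex → Ω → ℝ}

lemma measurable_diagramField (hX : ∀ z, Measurable (X z)) (a b : ℕ → ℕ) (z : CornerIndex) :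
    Measurable fun o => diagramField (fun z => X z o) a b z := by
  have hg : ∀ m n, Measurable fun o => fieldGrowth (fun z => X z o) m n := fun m n =>
    measurable_growth (fun i => hX (.inl i)) (fun j => hX (.inr (.inl j)))
      (fun i j => hX (.inr (.inr (i, j)))) m n
  rcases z with i | j | ⟨i, j⟩
  · exact (hg _ _).sub (hg _ _)
  · exact (hg _ _).sub (hg _ _)
  · simp only [diagramField]
    split_ifs
    · exact ((hg _ _).sub (hg _ _)).min ((hg _ _).sub (hg _ _))
    · exact hX _

variable [IsProbabilityMeasure P] {r s : ℝ}

lemma IndepLaws.diagramField_add_cell (hr : 0 < r) (hs : 0 < s) (hrs : r + s = 1)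
    (hX : ∀ z, Measurable (X z)) {a b : ℕ → ℕ} {i j : ℕ} (ha : a i = j) (hb : b j = i)
    (h : IndepLaws P (fun z o => diagramField (fun z => X z o) a b z) (cornerLaw r s)) :
    IndepLaws P (fun z o => diagramField (fun z => X z o) (Function.update a i (j + 1))
      (Function.update b j (i + 1)) z) (cornerLaw r s) := by
  have : ∀ z, IsProbabilityMeasure (cornerLaw r s z) := by
    rintro (i | j | ⟨i, j⟩)
    · exact isProbabilityMeasure_expMeasure hr
    · exact isProbabilityMeasure_expMeasure hs
    · exact isProbabilityMeasure_expMeasure one_pos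
  exact h.update_three (measurable_diagramField hX a b) (i := .inl i) (j := .inr (.inl j))
    (k := .inr (.inr (i, j))) (by simp) (by simp) (by simp) (measurePreserving_burkeMap hr hs hrs)
    (fun o => _root_.diagramField_add_cell _ ha hb)
    (fun z h1 h2 h3 => funext fun o => diagramField_add_cell_of_ne _ ha h1 h2 h3)

lemma IndepLaws.diagramField_rectangle (hr : 0 < r) (hs : 0 < s) (hrs : r + s = 1)
    (hX : ∀ z, Measurable (X z)) (h : IndepLaws P X (cornerLaw r s)) (m n : ℕ) :
    IndepLaws P (fun z o => diagramField (fun z => X z o) (fun i => if i < m then n else 0)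
      (fun j => if j < n then m else 0) z) (cornerLaw r s) := by
  induction n with
  | zero =>
    have e : (fun i => if i < m then 0 else 0 : ℕ → ℕ) = 0 := by funext i; simp
    have e' : (fun j => if j < 0 then m else 0 : ℕ → ℕ) = 0 := by funext i; simp
    rw [e, e']
    simpa only [diagramField_zero] using h
  | succ n ih =>
    -- The diagram here has `n` full rows and `k` cells in the next one, so each step adds one
    -- corner cell.
    have row : ∀ k ≤ m, IndepLaws P (fun z o => diagramField (fun z => X z o)
        (fun i => if i < k then n + 1 else if i < m then n else 0)
        (fun j => if j < n then m else if j = n then k else 0) z) (cornerLaw r s) := by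
      intro k
      induction k with
      | zero =>
        intro _
        convert! ih using 5
        · split_ifs <;> omega
      | succ k ihk =>
        intro hk
        convert! (ihk (by omega)).diagramField_add_cell hr hs hrs hX (i := k) (j := n)
          (by simp; omega) (by simp) using 5
        · simp only [Function.update_apply]
          split_ifs <;> omega
        · simp only [Function.update_apply]
          split_ifs <;> omega
    convert! row m le_rfl using 5
    · split_ifs <;> omega
    · split_ifs <;> omega

end

/-! ### Exponential moments and a strong law for arrays -/

lemma lintegral_exp_mul_expMeasure {r θ : ℝ} (hr : 0 < r) (hθ : θ < r) :
    ∫⁻ x, ENNReal.ofReal (Real.exp (θ * x)) ∂(expMeasure r) = ENNReal.ofReal (r / (r - θ)) := by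
  have hd : 0 < r - θ := by linarith
  rw [expMeasure_eq_withDensity, lintegral_withDensity_eq_lintegral_mul _
    (measurable_exponentialPDF r) (by fun_prop)]
  have e : ∀ x : ℝ, (exponentialPDF r * fun x => ENNReal.ofReal (Real.exp (θ * x))) x =
      ENNReal.ofReal (r / (r - θ)) * exponentialPDF (r - θ) x := by
    intro x
    rcases lt_or_ge x 0 with hx | hx
    · simp [Pi.mul_apply, exponentialPDF_of_neg hx]
    · rw [Pi.mul_apply, exponentialPDF_of_nonneg hx, exponentialPDF_of_nonneg hx,
        ← ENNReal.ofReal_mul (by positivity), ← ENNReal.ofReal_mul (by positivity)]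
      congr 1
      rw [mul_assoc, ← Real.exp_add, ← mul_assoc, div_mul_cancel₀ _ hd.ne']
      congr 2
      ring
  simp_rw [e]
  rw [lintegral_const_mul _ (measurable_exponentialPDF _), lintegral_exponentialPDF_eq_one hd,
    mul_one]

section

variable {Ω : Type*} [MeasurableSpace Ω] {P : Measure Ω}

lemma lintegral_exp_mul_of_hasLaw {X : Ω → ℝ} {r θ : ℝ} (hX : HasLaw X (expMeasure r) P)
    (hr : 0 < r) (hθ : θ < r) :
    ∫⁻ a, ENNReal.ofReal (Real.exp (θ * X a)) ∂P = ENNReal.ofReal (r / (r - θ)) := by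
  rw [← lintegral_exp_mul_expMeasure hr hθ]
  exact hX.lintegral_comp (f := fun x => ENNReal.ofReal (Real.exp (θ * x))) (by fun_prop)

lemma integrable_exp_mul_of_hasLaw {X : Ω → ℝ} {r θ : ℝ} (hX : HasLaw X (expMeasure r) P)
    (hr : 0 < r) (hθ : θ < r) : Integrable (fun a => Real.exp (θ * X a)) P := by
  refine ⟨(Real.measurable_exp.comp_aemeasurable
    (hX.aemeasurable.const_mul θ)).aestronglyMeasurable, ?_⟩
  rw [hasFiniteIntegral_iff_ofReal (Eventually.of_forall fun _ => (Real.exp_pos _).le),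
    lintegral_exp_mul_of_hasLaw hX hr hθ]
  exact ENNReal.ofReal_lt_top

lemma mgf_of_hasLaw_expMeasure {X : Ω → ℝ} {r θ : ℝ} (hX : HasLaw X (expMeasure r) P)
    (hr : 0 < r) (hθ : θ < r) : mgf X P θ = r / (r - θ) := by
  have hd : 0 < r - θ := by linarith
  rw [mgf, integral_eq_lintegral_of_nonneg_ae
    (Eventually.of_forall fun _ => (Real.exp_pos _).le)
    (integrable_exp_mul_of_hasLaw hX hr hθ).aestronglyMeasurable,
    lintegral_exp_mul_of_hasLaw hX hr hθ, ENNReal.toReal_ofReal (by positivity)]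

/-- `(1 - θ)(1 + θ + 2θ²) = 1 + θ²(1 - 2θ) ≥ 1`. Negative `θ` is allowed, so one bound serves both
tails. -/
lemma one_div_one_sub_le_exp {θ : ℝ} (hθ : θ ≤ 1 / 2) :
    1 / (1 - θ) ≤ Real.exp (θ + 2 * θ ^ 2) := by
  have hd : 0 < 1 - θ := by linarith
  rw [div_le_iff₀ hd]
  have h1 := Real.add_one_le_exp (θ + 2 * θ ^ 2)
  have h2 := mul_le_mul_of_nonneg_right h1 hd.le
  nlinarith [mul_nonneg (sq_nonneg θ) (by linarith : (0 : ℝ) ≤ 1 - 2 * θ)]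

lemma mgf_sum_le_of_hasLaw_expMeasure {Y : ℕ → Ω → ℝ} {r θ : ℝ} (hr : 0 < r)
    (hind : iIndepFun Y P) (hlaw : ∀ i, HasLaw (Y i) (expMeasure r) P) (hθ : θ ≤ 1 / 2) (m : ℕ) :
    mgf (∑ i ∈ Finset.range m, Y i) P (r * θ) ≤ Real.exp (m * (θ + 2 * θ ^ 2)) := by
  have hlt : r * θ < r := by nlinarith
  rw [hind.mgf_sum₀ fun i => (hlaw i).aemeasurable]
  calc ∏ i ∈ Finset.range m, mgf (Y i) P (r * θ) = ∏ _i ∈ Finset.range m, 1 / (1 - θ) := by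
        refine Finset.prod_congr rfl fun i _ => ?_
        rw [mgf_of_hasLaw_expMeasure (hlaw i) hr hlt]
        have : 1 - θ ≠ 0 := by linarith
        have : r - r * θ ≠ 0 := by linarith
        field_simp
    _ ≤ ∏ _i ∈ Finset.range m, Real.exp (θ + 2 * θ ^ 2) :=
        Finset.prod_le_prod (fun _ _ => by
          have : 0 < 1 - θ := by linarith
          positivity) fun _ _ => one_div_one_sub_le_exp hθ
    _ = Real.exp (m * (θ + 2 * θ ^ 2)) := by
        rw [Finset.prod_const, Finset.card_range, ← Real.exp_nat_mul]

/-- Chernoff bound for sums of independent exponential variables. -/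
lemma measure_abs_sum_sub_ge_le [IsProbabilityMeasure P] {Y : ℕ → Ω → ℝ} {r θ : ℝ} (hr : 0 < r)
    (hY : ∀ i, Measurable (Y i)) (hind : iIndepFun Y P)
    (hlaw : ∀ i, HasLaw (Y i) (expMeasure r) P) (hθ0 : 0 ≤ θ)
    (hθ : θ ≤ 1 / 2) (m : ℕ) (δ : ℝ) :
    P.real {a | δ ≤ |∑ i ∈ Finset.range m, Y i a - m / r|} ≤
      2 * Real.exp (2 * m * θ ^ 2 - r * θ * δ) := by
  have hint : ∀ t : ℝ, t < r →
      Integrable (fun a => Real.exp (t * (∑ i ∈ Finset.range m, Y i) a)) P := fun t ht =>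
    hind.integrable_exp_mul_sum hY
      fun i _ => integrable_exp_mul_of_hasLaw (hlaw i) hr ht
  have hup := measure_ge_le_exp_mul_mgf (m / r + δ) (by positivity : 0 ≤ r * θ)
    (hint (r * θ) (by nlinarith))
  have hlo := measure_le_le_exp_mul_mgf (m / r - δ) (by nlinarith : r * (-θ) ≤ 0)
    (hint (r * (-θ)) (by nlinarith))
  have hmu := mgf_sum_le_of_hasLaw_expMeasure hr hind hlaw hθ m
  have hml := mgf_sum_le_of_hasLaw_expMeasure hr hind hlaw (by linarith : -θ ≤ 1 / 2) m
  have hsub : {a | δ ≤ |∑ i ∈ Finset.range m, Y i a - m / r|} ⊆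
      {a | m / r + δ ≤ (∑ i ∈ Finset.range m, Y i) a} ∪
        {a | (∑ i ∈ Finset.range m, Y i) a ≤ m / r - δ} := by
    intro a ha
    simp only [Set.mem_ofPred_eq, Set.mem_union, Finset.sum_apply] at ha ⊢
    rcases le_abs.1 ha with h | h
    · left; linarith
    · right; linarith
  have e1 : Real.exp (-(r * θ) * (m / r + δ)) * Real.exp (m * (θ + 2 * θ ^ 2)) =
      Real.exp (2 * m * θ ^ 2 - r * θ * δ) := by
    rw [← Real.exp_add]
    congr 1
    field_simp
    ring
  have e2 : Real.exp (-(r * -θ) * (m / r - δ)) * Real.exp (m * (-θ + 2 * (-θ) ^ 2)) =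
      Real.exp (2 * m * θ ^ 2 - r * θ * δ) := by
    rw [← Real.exp_add]
    congr 1
    field_simp
    ring
  have b1 := hup.trans (mul_le_mul_of_nonneg_left hmu (Real.exp_pos _).le)
  have b2 := hlo.trans (mul_le_mul_of_nonneg_left hml (Real.exp_pos _).le)
  rw [e1] at b1
  rw [e2] at b2
  calc _ ≤ _ := measureReal_mono hsub
    _ ≤ _ := measureReal_union_le _ _
    _ ≤ _ := by linarith

/-- Nothing relates the rows `Y N` for different `N`, so the classical strong law does not apply;
the Chernoff bounds are summable and Borel–Cantelli concludes. -/
lemma ae_eventually_abs_sum_sub_lt [IsProbabilityMeasure P] {Y : ℕ → ℕ → Ω → ℝ} {r : ℝ} (hr : 0 < r)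
    (hY : ∀ N i, Measurable (Y N i)) (hind : ∀ N, iIndepFun (Y N) P)
    (hlaw : ∀ N i, HasLaw (Y N i) (expMeasure r) P)
    {m : ℕ → ℕ} {x : ℝ} (hm : Tendsto (fun N : ℕ => (N : ℝ)⁻¹ * m N) atTop (𝓝 x))
    {δ : ℝ} (hδ : 0 < δ) :
    ∀ᵐ a ∂P, ∀ᶠ N : ℕ in atTop, |∑ i ∈ Finset.range (m N), Y N i a - m N / r| < δ * N := by
  have hx : 0 ≤ x := ge_of_tendsto' hm fun N => by positivity
  -- Eventually `m N ≤ C N`; the choice of `θ` below makes the quadratic term of the Chernoff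
  -- exponent at most half of the linear one, leaving `-c N`.
  set C := x + 1 with hC
  have hC0 : 0 < C := by linarith
  have hmC : ∀ᶠ N : ℕ in atTop, (m N : ℝ) ≤ C * N := by
    filter_upwards [hm.eventually_lt_const (by linarith : x < C), eventually_gt_atTop 0]
      with N hN hN0
    have hN0' : (0 : ℝ) < N := by exact_mod_cast hN0
    rw [inv_mul_lt_iff₀ hN0'] at hN
    linarith
  set θ := min (1 / 2) (r * δ / (4 * C)) with hθ
  have hθ0 : 0 < θ := lt_min (by norm_num) (by positivity)
  have hθ2 : θ ≤ 1 / 2 := min_le_left _ _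
  have hθ3 : 4 * C * θ ≤ r * δ := by
    have := min_le_right (1 / 2) (r * δ / (4 * C))
    rw [← hθ, le_div_iff₀ (by positivity)] at this
    linarith
  set c := r * θ * δ / 2 with hc
  have hc0 : 0 < c := by positivity
  have hbound : ∀ᶠ N : ℕ in atTop,
      ‖P.real {a | δ * N ≤ |∑ i ∈ Finset.range (m N), Y N i a - m N / r|}‖ ≤
        2 * Real.exp (-c) ^ N := by
    filter_upwards [hmC] with N hN
    rw [Real.norm_of_nonneg measureReal_nonneg]
    refine (measure_abs_sum_sub_ge_le hr (hY N) (hind N) (hlaw N) hθ0.le hθ2 (m N) (δ * N)).trans ?_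
    rw [← Real.exp_nat_mul]
    gcongr
    have h1 : 2 * (m N : ℝ) * θ ^ 2 ≤ 2 * (C * N) * θ ^ 2 := by gcongr
    have h2 : 4 * C * θ * (θ * N) ≤ r * δ * (θ * N) := by gcongr
    rw [hc]
    nlinarith
  have hsum : Summable fun N : ℕ =>
      P.real {a | δ * N ≤ |∑ i ∈ Finset.range (m N), Y N i a - m N / r|} :=
    Summable.of_norm_bounded_eventually_nat
      ((summable_geometric_of_lt_one (Real.exp_pos _).le
        (Real.exp_lt_one_iff.2 (by linarith : -c < 0))).mul_left 2) hbound
  have hne : (∑' N : ℕ, P {a | δ * N ≤ |∑ i ∈ Finset.range (m N), Y N i a - m N / r|}) ≠ ⊤ := by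
    rw [tsum_congr fun N => (ofReal_measureReal (h := measure_ne_top P _)).symm]
    exact hsum.tsum_ofReal_ne_top
  filter_upwards [ae_eventually_notMem hne] with a ha
  filter_upwards [ha] with N hN
  simpa using hN

/-- Strong law of large numbers for triangular arrays of independent exponential variables. -/
theorem tendsto_sum_of_hasLaw_expMeasure [IsProbabilityMeasure P] {Y : ℕ → ℕ → Ω → ℝ} {r : ℝ} (hr : 0 < r)
    (hY : ∀ N i, Measurable (Y N i)) (hind : ∀ N, iIndepFun (Y N) P)
    (hlaw : ∀ N i, HasLaw (Y N i) (expMeasure r) P)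
    {m : ℕ → ℕ} {x : ℝ} (hm : Tendsto (fun N : ℕ => (N : ℝ)⁻¹ * m N) atTop (𝓝 x)) :
    ∀ᵐ a ∂P, Tendsto (fun N : ℕ => (N : ℝ)⁻¹ * ∑ i ∈ Finset.range (m N), Y N i a)
      atTop (𝓝 (x / r)) := by
  have h := ae_all_iff.2 fun k : ℕ =>
    ae_eventually_abs_sum_sub_lt hr hY hind hlaw hm (Nat.one_div_pos_of_nat (α := ℝ) (n := k))
  filter_upwards [h] with a ha
  have h1 : Tendsto (fun N : ℕ => (N : ℝ)⁻¹ * m N / r) atTop (𝓝 (x / r)) := hm.div_const r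
  have h2 : Tendsto (fun N : ℕ => (N : ℝ)⁻¹ *
      (∑ i ∈ Finset.range (m N), Y N i a - m N / r)) atTop (𝓝 0) := by
    rw [Metric.tendsto_atTop']
    intro ε hε
    obtain ⟨k, hk⟩ := exists_nat_one_div_lt hε
    obtain ⟨N₀, hN₀⟩ := eventually_atTop.1 (ha k)
    refine ⟨N₀, fun N hN => ?_⟩
    have hN0 : (0 : ℝ) < N := by
      have : 0 < N := by omega
      exact_mod_cast this
    rw [Real.dist_eq, sub_zero, abs_mul, abs_of_pos (inv_pos.2 hN0), inv_mul_lt_iff₀ hN0]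
    have := hN₀ N hN.le
    nlinarith
  convert! h2.add h1 using 1
  · funext N; ring
  · rw [zero_add]

end

/-! ### Deterministic comparison of growth processes -/

section

variable {h v h₁ v₁ h₂ v₂ : ℕ → ℝ} {w : ℕ → ℕ → ℝ}

lemma add_growth_left_le (h v : ℕ → ℝ) (w : ℕ → ℕ → ℝ) (m n : ℕ) :
    w m n + growth h v w m (n + 1) ≤ growth h v w (m + 1) (n + 1) := by
  rw [growth_succ]
  gcongr
  exact le_max_left _ _

lemma add_growth_right_le (h v : ℕ → ℝ) (w : ℕ → ℕ → ℝ) (m n : ℕ) :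
    w m n + growth h v w (m + 1) n ≤ growth h v w (m + 1) (n + 1) := by
  rw [growth_succ]
  gcongr
  exact le_max_right _ _

lemma growth_mono (hh : ∀ i, h i ≤ h₁ i) (hv : ∀ j, v j ≤ v₁ j) (m n : ℕ) :
    growth h v w m n ≤ growth h₁ v₁ w m n := by
  induction m generalizing n with
  | zero =>
    simp only [growth_zero_left]
    exact Finset.sum_le_sum fun j _ => hv j
  | succ m ihm =>
    induction n with
    | zero =>
      simp only [growth_zero_right]
      exact Finset.sum_le_sum fun i _ => hh i
    | succ n ihn =>
      rw [growth_succ, growth_succ]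
      gcongr
      exact ihm (n + 1)

lemma growth_zero_nonneg (hw : ∀ i j, 0 ≤ w i j) (m n : ℕ) : 0 ≤ growth 0 0 w m n := by
  cases m with
  | zero => simp [growth_zero_left]
  | succ m =>
    induction n with
    | zero => simp [growth_zero_right]
    | succ n ih => exact (add_nonneg (hw m n) ih).trans (add_growth_right_le 0 0 w m n)

lemma sum_row_le_growth (hw : ∀ i j, 0 ≤ w i j) (m n : ℕ) :
    ∑ i ∈ Finset.range m, w i 0 ≤ growth 0 0 w m (n + 1) := by
  induction n with
  | zero =>
    induction m with
    | zero => simp [growth_zero_left]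
    | succ m ih =>
      rw [Finset.sum_range_succ, add_comm]
      exact (by gcongr : _ ≤ w m 0 + growth 0 0 w m (0 + 1)).trans (add_growth_left_le 0 0 w m 0)
  | succ n ih =>
    cases m with
    | zero => simp [growth_zero_left]
    | succ m =>
      have := add_growth_right_le 0 0 w m (n + 1)
      linarith [hw m (n + 1)]

lemma sum_column_le_growth (hw : ∀ i j, 0 ≤ w i j) (m n : ℕ) :
    ∑ j ∈ Finset.range n, w 0 j ≤ growth 0 0 w (m + 1) n := by
  induction m with
  | zero =>
    induction n with
    | zero => simp [growth_zero_right]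
    | succ n ih =>
      rw [Finset.sum_range_succ, add_comm]
      exact (by gcongr : _ ≤ w 0 n + growth 0 0 w (0 + 1) n).trans (add_growth_right_le 0 0 w 0 n)
  | succ m ih =>
    cases n with
    | zero => simp [growth_zero_right]
    | succ n =>
      have := add_growth_left_le 0 0 w (m + 1) n
      linarith [hw (m + 1) n]

lemma sum_range_le_sum_range {f : ℕ → ℝ} (hf : ∀ i, 0 ≤ f i) {k l : ℕ} (hkl : k ≤ l) :
    ∑ i ∈ Finset.range k, f i ≤ ∑ i ∈ Finset.range l, f i :=
  Finset.sum_le_sum_of_subset_of_nonneg (Finset.range_mono hkl) fun i _ _ => hf i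

/-- A maximal path leaves the boundary within distance `K` of the corner, or it can be compared
with a growth process that has larger increments on the side of the boundary it follows. -/
theorem growth_trichotomy (hh : ∀ i, 0 ≤ h i) (hv : ∀ j, 0 ≤ v j)
    (hh₁ : ∀ i, h i ≤ h₁ i) (hv₂ : ∀ j, v j ≤ v₂ j) (K m n : ℕ) :
    growth h v w (m + 1) (n + 1) ≤
        max (∑ i ∈ Finset.range K, h i) (∑ j ∈ Finset.range K, v j) +
          growth 0 0 w (m + 1) (n + 1) ∨
      growth h v w (m + 1) (n + 1) ≤
        growth h₁ v₁ w (m + 1) (n + 1) - ∑ i ∈ Finset.range K, (h₁ i - h i) ∨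
      growth h v w (m + 1) (n + 1) ≤
        growth h₂ v₂ w (m + 1) (n + 1) - ∑ j ∈ Finset.range K, (v₂ j - v j) := by
  -- All three alternatives survive a step, since each right-hand process gains at least `w m n`.
  -- The choice is made where the path leaves an axis: before `K` gives the first, after `K` one of
  -- the others. A path leaving one axis never uses the other, so `v₁` and `h₂` can be arbitrary.
  have left : ∀ m n, (∀ m', m = m' + 1 → growth h v w m (n + 1) ≤
        max (∑ i ∈ Finset.range K, h i) (∑ j ∈ Finset.range K, v j) +
          growth 0 0 w m (n + 1) ∨
      growth h v w m (n + 1) ≤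
        growth h₁ v₁ w m (n + 1) - ∑ i ∈ Finset.range K, (h₁ i - h i) ∨
      growth h v w m (n + 1) ≤
        growth h₂ v₂ w m (n + 1) - ∑ j ∈ Finset.range K, (v₂ j - v j)) →
      w m n + growth h v w m (n + 1) ≤
        max (∑ i ∈ Finset.range K, h i) (∑ j ∈ Finset.range K, v j) +
          growth 0 0 w (m + 1) (n + 1) ∨
      w m n + growth h v w m (n + 1) ≤
        growth h₁ v₁ w (m + 1) (n + 1) - ∑ i ∈ Finset.range K, (h₁ i - h i) ∨
      w m n + growth h v w m (n + 1) ≤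
        growth h₂ v₂ w (m + 1) (n + 1) - ∑ j ∈ Finset.range K, (v₂ j - v j) := by
    intro m n ih
    have e0 := add_growth_left_le 0 0 w m n
    have e1 := add_growth_left_le h₁ v₁ w m n
    have e2 := add_growth_left_le h₂ v₂ w m n
    cases m with
    | zero =>
      rw [growth_zero_left] at e0 e2 ⊢
      rcases le_total (n + 1) K with hK | hK
      · left
        have := sum_range_le_sum_range hv hK
        have := le_max_right (∑ i ∈ Finset.range K, h i) (∑ j ∈ Finset.range K, v j)
        simp only [Pi.zero_apply, Finset.sum_const_zero] at e0
        linarith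
      · right; right
        have := sum_range_le_sum_range (f := fun j => v₂ j - v j)
          (fun j => sub_nonneg.2 (hv₂ j)) hK
        rw [Finset.sum_sub_distrib (s := Finset.range (n + 1))] at this
        linarith
    | succ m =>
      rcases ih m rfl with H | H | H
      · left; linarith
      · right; left; linarith
      · right; right; linarith
  have right : ∀ m n, (∀ n', n = n' + 1 → growth h v w (m + 1) n ≤
        max (∑ i ∈ Finset.range K, h i) (∑ j ∈ Finset.range K, v j) +
          growth 0 0 w (m + 1) n ∨
      growth h v w (m + 1) n ≤
        growth h₁ v₁ w (m + 1) n - ∑ i ∈ Finset.range K, (h₁ i - h i) ∨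
      growth h v w (m + 1) n ≤
        growth h₂ v₂ w (m + 1) n - ∑ j ∈ Finset.range K, (v₂ j - v j)) →
      w m n + growth h v w (m + 1) n ≤
        max (∑ i ∈ Finset.range K, h i) (∑ j ∈ Finset.range K, v j) +
          growth 0 0 w (m + 1) (n + 1) ∨
      w m n + growth h v w (m + 1) n ≤
        growth h₁ v₁ w (m + 1) (n + 1) - ∑ i ∈ Finset.range K, (h₁ i - h i) ∨
      w m n + growth h v w (m + 1) n ≤
        growth h₂ v₂ w (m + 1) (n + 1) - ∑ j ∈ Finset.range K, (v₂ j - v j) := by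
    intro m n ih
    have e0 := add_growth_right_le 0 0 w m n
    have e1 := add_growth_right_le h₁ v₁ w m n
    have e2 := add_growth_right_le h₂ v₂ w m n
    cases n with
    | zero =>
      rw [growth_zero_right] at e0 e1 ⊢
      rcases le_total (m + 1) K with hK | hK
      · left
        have := sum_range_le_sum_range hh hK
        have := le_max_left (∑ i ∈ Finset.range K, h i) (∑ j ∈ Finset.range K, v j)
        simp only [Pi.zero_apply, Finset.sum_const_zero] at e0
        linarith
      · right; left
        have := sum_range_le_sum_range (f := fun i => h₁ i - h i)
          (fun i => sub_nonneg.2 (hh₁ i)) hK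
        rw [Finset.sum_sub_distrib (s := Finset.range (m + 1))] at this
        linarith
    | succ n =>
      rcases ih n rfl with H | H | H
      · left; linarith
      · right; left; linarith
      · right; right; linarith
  have combine : ∀ m n, growth h v w (m + 1) (n + 1) = w m n + growth h v w m (n + 1) ∨
      growth h v w (m + 1) (n + 1) = w m n + growth h v w (m + 1) n := fun m n => by
    rw [growth_succ]
    rcases max_choice (growth h v w m (n + 1)) (growth h v w (m + 1) n) with e | e
    · left; rw [e]
    · right; rw [e]
  induction m generalizing n with
  | zero =>
    induction n with
    | zero =>
      rcases combine 0 0 with e | e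
      · rw [e]; exact left 0 0 (by simp)
      · rw [e]; exact right 0 0 (by simp)
    | succ n ihn =>
      rcases combine 0 (n + 1) with e | e
      · rw [e]; exact left 0 (n + 1) (by simp)
      · rw [e]; exact right 0 (n + 1) fun _ _ => ihn
  | succ m ihm =>
    induction n with
    | zero =>
      rcases combine (m + 1) 0 with e | e
      · rw [e]; exact left (m + 1) 0 fun _ _ => ihm 0
      · rw [e]; exact right (m + 1) 0 (by simp)
    | succ n ihn =>
      rcases combine (m + 1) (n + 1) with e | e
      · rw [e]; exact left (m + 1) (n + 1) fun _ _ => ihm (n + 1)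
      · rw [e]; exact right (m + 1) (n + 1) fun _ _ => ihn

end

/-! ### Optimising the rate -/

section

lemma exists_rates_lt {x y b : ℝ} (hx : 0 ≤ x) (hy : 0 ≤ y) (hb : (√x + √y) ^ 2 < b) :
    ∃ r s : ℝ, 0 < r ∧ 0 < s ∧ r + s = 1 ∧ x / r + y / s < b := by
  set p := √x with hp
  set q := √y with hq
  have hp0 : 0 ≤ p := Real.sqrt_nonneg x
  have hq0 : 0 ≤ q := Real.sqrt_nonneg y
  have hpx : x = p ^ 2 := (Real.sq_sqrt hx).symm
  have hqy : y = q ^ 2 := (Real.sq_sqrt hy).symm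
  -- The minimiser `p / (p + q)` is not an admissible rate if `p` or `q` vanishes; shifting both by
  -- `δ` repairs this at a cost of at most `2 (p + q) δ`, less than the gap to `b`.
  set δ := (b - (p + q) ^ 2) / (2 * (p + q) + 1) / 2 with hδ
  have hδ0 : 0 < δ := by
    have : 0 < b - (p + q) ^ 2 := by linarith
    positivity
  have hδ1 : (2 * (p + q) + 1) * δ = (b - (p + q) ^ 2) / 2 := by
    rw [hδ]
    have : 2 * (p + q) + 1 ≠ 0 := by positivity
    field_simp
  set D := p + q + 2 * δ with hD
  have hD0 : 0 < D := by positivity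
  refine ⟨(p + δ) / D, (q + δ) / D, by positivity, by positivity, ?_, ?_⟩
  · rw [← add_div, div_eq_one_iff_eq hD0.ne']; rw [hD]; ring
  · have aux : ∀ t : ℝ, 0 ≤ t → t ^ 2 / ((t + δ) / D) ≤ t * D := by
      intro t ht
      rw [div_div_eq_mul_div, div_le_iff₀ (by positivity)]
      nlinarith [mul_nonneg (mul_nonneg ht hD0.le) hδ0.le]
    rw [hpx, hqy]
    have := aux p hp0
    have := aux q hq0
    have e : p * D + q * D = (p + q) ^ 2 + 2 * (p + q) * δ := by rw [hD]; ring
    nlinarith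

/-- Perturbing the optimal rate changes the linear function to second order only. -/
lemma exists_rate_perturbation {x y r s ε : ℝ} (hr : 0 < r) (hs : 0 < s) (hrs : r + s = 1)
    (hxy : x * s ^ 2 = y * r ^ 2) (hε : 0 < ε) :
    ∃ r' s' : ℝ, 0 < r' ∧ 0 < s' ∧ r' + s' = 1 ∧ r' < r ∧
      x / r' + y / s' - ε * (1 / r' - 1 / r) < x / r + y / s := by
  -- This is the factor left after extracting `r - t` from the difference of the two sides; at `t =
  -- r` it equals `ε s²` by `hxy`, hence is positive nearby.
  have hf : ContinuousAt (fun t : ℝ => y * r * t - (x - ε) * s * (1 - t)) r := by fun_prop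
  have hpos : 0 < y * r * r - (x - ε) * s * (1 - r) := by
    have e : 1 - r = s := by linarith
    rw [e]
    nlinarith [mul_pos hε (pow_pos hs 2)]
  have h1 : ∀ᶠ t in 𝓝[<] r, 0 < y * r * t - (x - ε) * s * (1 - t) :=
    (hf.eventually_const_lt hpos).filter_mono nhdsWithin_le_nhds
  have h2 : ∀ᶠ t in 𝓝[<] r, 0 < t :=
    (eventually_gt_nhds hr).filter_mono nhdsWithin_le_nhds
  obtain ⟨t, ⟨ht1, ht2⟩, ht3⟩ := ((h1.and h2).and self_mem_nhdsWithin).exists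
  have ht3 : t < r := ht3
  have ht4 : 0 < 1 - t := by linarith
  refine ⟨t, 1 - t, ht2, ht4, by ring, ht3, ?_⟩
  have hs' : s = 1 - r := by linarith
  have e : x / r + y / s - (x / t + y / (1 - t) - ε * (1 / t - 1 / r)) =
      (r - t) * (y * r * t - (x - ε) * s * (1 - t)) / (r * t * s * (1 - t)) := by
    rw [hs'] at hs ⊢
    field_simp
    ring
  have : 0 < (r - t) * (y * r * t - (x - ε) * s * (1 - t)) / (r * t * s * (1 - t)) := by
    have : 0 < r - t := by linarith
    positivity
  linarith

lemma tendsto_inv_mul_floor {x : ℝ} (hx : 0 ≤ x) :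
    Tendsto (fun N : ℕ => (N : ℝ)⁻¹ * (⌊(N : ℝ) * x⌋₊ : ℝ)) atTop (𝓝 x) := by
  have := (tendsto_nat_floor_mul_div_atTop hx).comp (tendsto_natCast_atTop_atTop (R := ℝ))
  refine this.congr fun N => ?_
  simp only [Function.comp]
  rw [mul_comm x, div_eq_inv_mul]

lemma tendsto_inv_mul_floor_add_one {x : ℝ} (hx : 0 ≤ x) :
    Tendsto (fun N : ℕ => (N : ℝ)⁻¹ * ((⌊(N : ℝ) * x⌋₊ + 1 : ℕ) : ℝ)) atTop (𝓝 x) := by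
  have := (tendsto_inv_mul_floor hx).add (tendsto_inv_atTop_nhds_zero_nat (𝕜 := ℝ))
  rw [add_zero] at this
  refine this.congr fun N => ?_
  push_cast
  ring

end

/-! ### Coupled stationary models and their limit -/

lemma map_inv_mul_expMeasure {r : ℝ} (hr : 0 < r) :
    (expMeasure 1).map (fun x => r⁻¹ * x) = expMeasure r := by
  have := isProbabilityMeasure_expMeasure hr
  have := isProbabilityMeasure_expMeasure one_pos
  have hm : Measurable fun x : ℝ => r⁻¹ * x := by fun_prop
  have := Measure.isProbabilityMeasure_map (μ := expMeasure 1) hm.aemeasurable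
  apply Measure.eq_of_cdf
  ext x
  have e : (fun x : ℝ => r⁻¹ * x) ⁻¹' Set.Iic x = Set.Iic (r * x) := by
    ext y
    simp only [Set.mem_preimage, Set.mem_Iic]
    rw [inv_mul_le_iff₀ hr]
  rw [cdf_eq_real, map_measureReal_apply hm measurableSet_Iic, e, ← cdf_eq_real,
    cdf_expMeasure_eq one_pos, cdf_expMeasure_eq hr, one_mul]
  simp only [mul_nonneg_iff_of_pos_left hr]

/-- The boundary and bulk field of the stationary model with rates `r` and `s`, built from a rate
one field on the lattice. -/
noncomputable def stationaryField (r s : ℝ) (w : ℤ × ℤ → ℝ) : CornerIndex → ℝ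
  | .inl i => r⁻¹ * w (i, -1)
  | .inr (.inl j) => s⁻¹ * w (-1, j)
  | .inr (.inr (i, j)) => w (i, j)

section

variable {Ω : Type*} [MeasurableSpace Ω] {P : Measure Ω} {ω : ℤ × ℤ → Ω → ℝ}

lemma measurable_stationaryField (hω : ∀ z, Measurable (ω z)) (r s : ℝ) (z : CornerIndex) :
    Measurable fun a => stationaryField r s (fun x => ω x a) z := by
  rcases z with i | j | ⟨i, j⟩
  · exact (hω _).const_mul _
  · exact (hω _).const_mul _
  · exact hω _

/-- Row `-1` and column `-1` are disjoint from the quadrant, so independence is inherited. All rates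
share the same noise, which makes the boundary weights monotone in the rate. -/
lemma indepLaws_stationaryField (hindep : iIndepFun ω P)
    (hexp : ∀ x, HasLaw (ω x) (expMeasure 1) P) {r s : ℝ} (hr : 0 < r) (hs : 0 < s) :
    IndepLaws P (fun z a => stationaryField r s (fun x => ω x a) z) (cornerLaw r s) := by
  have scaled : ∀ {t : ℝ}, 0 < t → ∀ x, HasLaw (fun a => t⁻¹ * ω x a) (expMeasure t) P :=
    fun {t} ht x => HasLaw.fun_comp (X := ω x) (Y := fun y => t⁻¹ * y)
      ⟨by fun_prop, map_inv_mul_expMeasure ht⟩ (hexp x)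
  let g : CornerIndex → ℤ × ℤ := fun
    | .inl i => (i, -1)
    | .inr (.inl j) => (-1, j)
    | .inr (.inr (i, j)) => (i, j)
  let c : CornerIndex → ℝ := fun
    | .inl _ => r⁻¹
    | .inr (.inl _) => s⁻¹
    | .inr (.inr _) => 1
  have hg : Function.Injective g := by
    rintro (i | j | ⟨i, j⟩) (i' | j' | ⟨i', j'⟩) h <;>
      simp only [g, Prod.mk.injEq] at h <;> simp only [Sum.inl.injEq, Sum.inr.injEq,
        Prod.mk.injEq, reduceCtorEq] <;> omega
  refine IndepLaws.of_iIndepFun ?_ ?_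
  · convert! (hindep.precomp hg).comp (fun z x => c z * x) (fun z => by fun_prop) using 1
    funext z a
    rcases z with i | j | ⟨i, j⟩ <;> simp [stationaryField, g, c]
  · rintro (i | j | ⟨i, j⟩)
    · exact scaled hr _
    · exact scaled hs _
    · exact hexp _

/-- Law of large numbers for the stationary corner growth model. -/
theorem tendsto_fieldGrowth [IsProbabilityMeasure P] {X : CornerIndex → Ω → ℝ} {r s : ℝ} (hr : 0 < r) (hs : 0 < s)
    (hrs : r + s = 1) (hX : ∀ z, Measurable (X z)) (h : IndepLaws P X (cornerLaw r s))
    {m n : ℕ → ℕ} {x y : ℝ}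
    (hm : Tendsto (fun N : ℕ => (N : ℝ)⁻¹ * m N) atTop (𝓝 x))
    (hn : Tendsto (fun N : ℕ => (N : ℝ)⁻¹ * n N) atTop (𝓝 y)) :
    ∀ᵐ a ∂P, Tendsto (fun N : ℕ => (N : ℝ)⁻¹ * fieldGrowth (fun z => X z a) (m N) (n N))
      atTop (𝓝 (x / r + y / s)) := by
  have hrect := fun N => h.diagramField_rectangle hr hs hrs hX (m N) (n N)
  have hmeas := fun N => measurable_diagramField hX (fun i => if i < m N then n N else 0)
    (fun j => if j < n N then m N else 0)
  -- The top row sits at height `n N` and changes with `N`, hence the array version. The two sums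
  -- need not be independent of each other.
  have h1 := tendsto_sum_of_hasLaw_expMeasure (P := P) hr
    (Y := fun N i a => diagramField (fun z => X z a) (fun i => if i < m N then n N else 0)
      (fun j => if j < n N then m N else 0) (.inl i))
    (fun N i => hmeas N (.inl i))
    (fun N => ((hrect N).iIndepFun (hmeas N)).precomp Sum.inl_injective)
    (fun N i => (hrect N).hasLaw (hmeas N) (.inl i)) hm
  have h2 := tendsto_sum_of_hasLaw_expMeasure (P := P) hs
    (Y := fun _ j => X (.inr (.inl j))) (fun _ j => hX _)
    (fun _ => (h.iIndepFun hX).precomp (Sum.inr_injective.comp Sum.inl_injective))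
    (fun _ j => h.hasLaw hX (.inr (.inl j))) hn
  filter_upwards [h1, h2] with a ha1 ha2
  rw [add_comm]
  refine (ha2.add ha1).congr fun N => ?_
  rw [← mul_add, fieldGrowth, growth_eq_sum_add_sum]
  congr 2
  refine Finset.sum_congr rfl fun i hi => ?_
  simp [diagramField, fieldGrowth, hIncr, Finset.mem_range.1 hi]

lemma ae_nonneg_of_hasLaw_expMeasure (hexp : ∀ x, HasLaw (ω x) (expMeasure 1) P) :
    ∀ᵐ a ∂P, ∀ x, 0 ≤ ω x a := by
  rw [ae_all_iff]
  intro x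
  rw [(hexp x).ae_iff (p := fun y => 0 ≤ y) (measurableSet_Ici (a := (0 : ℝ))).mem,
    expMeasure_eq_withDensity, ae_withDensity_iff (measurable_exponentialPDF 1)]
  refine Eventually.of_forall fun y hy => ?_
  by_contra hneg
  exact hy (exponentialPDF_of_neg (not_le.1 hneg))

/-! ### Upper and lower bounds -/

/-- The last-passage value of the `m × n` rectangle at the origin. -/
noncomputable def rectanglePassage (w : ℤ × ℤ → ℝ) : ℕ → ℕ → ℝ :=
  growth 0 0 fun i j => w (i, j)

variable [IsProbabilityMeasure P] {x y b : ℝ}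

lemma ae_eventually_rectanglePassage_lt (hω : ∀ z, Measurable (ω z)) (hindep : iIndepFun ω P)
    (hexp : ∀ x, HasLaw (ω x) (expMeasure 1) P) (hx : 0 ≤ x) (hy : 0 ≤ y)
    (hb : (√x + √y) ^ 2 < b) :
    ∀ᵐ a ∂P, ∀ᶠ N : ℕ in atTop, (N : ℝ)⁻¹ * rectanglePassage (fun x => ω x a)
      (⌊(N : ℝ) * x⌋₊ + 1) (⌊(N : ℝ) * y⌋₊ + 1) < b := by
  obtain ⟨r, s, hr, hs, hrs, hlt⟩ := exists_rates_lt hx hy hb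
  filter_upwards [tendsto_fieldGrowth hr hs hrs (measurable_stationaryField hω r s)
    (indepLaws_stationaryField hindep hexp hr hs) (tendsto_inv_mul_floor_add_one hx)
    (tendsto_inv_mul_floor_add_one hy), ae_nonneg_of_hasLaw_expMeasure hexp] with a ha hnn
  filter_upwards [ha.eventually_lt_const hlt] with N hN
  refine lt_of_le_of_lt ?_ hN
  gcongr
  exact growth_mono (fun i => mul_nonneg (inv_nonneg.2 hr.le) (hnn _))
    (fun j => mul_nonneg (inv_nonneg.2 hs.le) (hnn _)) _ _

lemma tendsto_sum_line (hω : ∀ z, Measurable (ω z)) (hindep : iIndepFun ω P)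
    (hexp : ∀ x, HasLaw (ω x) (expMeasure 1) P) {g : ℕ → ℤ × ℤ} (hg : Function.Injective g)
    {m : ℕ → ℕ} (hm : Tendsto (fun N : ℕ => (N : ℝ)⁻¹ * m N) atTop (𝓝 x)) :
    ∀ᵐ a ∂P, Tendsto (fun N : ℕ => (N : ℝ)⁻¹ * ∑ i ∈ Finset.range (m N), ω (g i) a)
      atTop (𝓝 x) := by
  have := tendsto_sum_of_hasLaw_expMeasure (P := P) one_pos (Y := fun _ i => ω (g i))
    (fun _ i => hω _) (fun _ => hindep.precomp hg) (fun _ i => hexp _) hm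
  simpa only [div_one] using this

lemma ae_eventually_lt_rectanglePassage_of_pos (hω : ∀ z, Measurable (ω z))
    (hindep : iIndepFun ω P) (hexp : ∀ x, HasLaw (ω x) (expMeasure 1) P) (hx : 0 < x)
    (hy : 0 < y) (hb : b < (√x + √y) ^ 2) :
    ∀ᵐ a ∂P, ∀ᶠ N : ℕ in atTop, b < (N : ℝ)⁻¹ * rectanglePassage (fun x => ω x a)
      (⌊(N : ℝ) * x⌋₊ + 1) (⌊(N : ℝ) * y⌋₊ + 1) := by
  have hp : 0 < √x := Real.sqrt_pos.2 hx
  have hq : 0 < √y := Real.sqrt_pos.2 hy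
  have hD : 0 < √x + √y := by positivity
  -- The minimiser of `x/r + y/s` on `r + s = 1`; `hchar` is the vanishing of the derivative.
  obtain ⟨r, hr_def⟩ : ∃ r, r = √x / (√x + √y) := ⟨_, rfl⟩
  obtain ⟨s, hs_def⟩ : ∃ s, s = √y / (√x + √y) := ⟨_, rfl⟩
  have hr : 0 < r := by rw [hr_def]; positivity
  have hs : 0 < s := by rw [hs_def]; positivity
  have hrs : r + s = 1 := by rw [hr_def, hs_def, ← add_div, div_self hD.ne']
  have hxr : x / r + y / s = (√x + √y) ^ 2 := by
    have e1 : x / r = √x * (√x + √y) := by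
      rw [hr_def, div_div_eq_mul_div, div_eq_iff hp.ne']
      nth_rewrite 1 [← Real.mul_self_sqrt hx.le]
      ring
    have e2 : y / s = √y * (√x + √y) := by
      rw [hs_def, div_div_eq_mul_div, div_eq_iff hq.ne']
      nth_rewrite 1 [← Real.mul_self_sqrt hy.le]
      ring
    rw [e1, e2]; ring
  have hchar : x * s ^ 2 = y * r ^ 2 := by
    rw [hr_def, hs_def, div_pow, div_pow, Real.sq_sqrt hx.le, Real.sq_sqrt hy.le]
    ring
  -- Boundary stretches of length `εN` on both axes weigh about `(ε/r + ε/s)N`, half of the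
  -- available gap.
  set ε := ((√x + √y) ^ 2 - b) / (2 * (1 / r + 1 / s)) with hε_def
  have hε : 0 < ε := by
    have : 0 < (√x + √y) ^ 2 - b := by linarith
    positivity
  have hεb : ε / r + ε / s < (√x + √y) ^ 2 - b := by
    have e : ε / r + ε / s = ((√x + √y) ^ 2 - b) / 2 := by
      have : 1 / r + 1 / s ≠ 0 := by positivity
      have h1 : ε * (2 * (1 / r + 1 / s)) = (√x + √y) ^ 2 - b := by
        rw [hε_def]; exact div_mul_cancel₀ _ (by positivity)
      have h2 : ε / r + ε / s = ε * (1 / r + 1 / s) := by ring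
      rw [h2]; linarith
    rw [e]; linarith
  obtain ⟨r₁, s₁, hr₁, hs₁, hrs₁, hrr₁, hlt₁⟩ := exists_rate_perturbation hr hs hrs hchar hε
  obtain ⟨s₂, r₂, hs₂, hr₂, hrs₂, hss₂, hlt₂⟩ :=
    exists_rate_perturbation hs hr (by linarith) hchar.symm hε
  rw [add_comm] at hrs₂
  have hlim : ∀ {r s : ℝ}, 0 < r → 0 < s → r + s = 1 → _ := fun {r s} hr hs hrs =>
    tendsto_fieldGrowth hr hs hrs (measurable_stationaryField hω r s)
    (indepLaws_stationaryField hindep hexp hr hs) (tendsto_inv_mul_floor_add_one hx.le)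
    (tendsto_inv_mul_floor_add_one hy.le)
  have hrow := tendsto_sum_line hω hindep hexp (g := fun i => ((i : ℤ), (-1 : ℤ)))
    (fun i j h => by simpa using h) (tendsto_inv_mul_floor hε.le)
  have hcol := tendsto_sum_line hω hindep hexp (g := fun i => ((-1 : ℤ), (i : ℤ)))
    (fun i j h => by simpa using h) (tendsto_inv_mul_floor hε.le)
  filter_upwards [hlim hr hs hrs, hlim hr₁ hs₁ hrs₁, hlim hr₂ hs₂ hrs₂, hrow, hcol,
    ae_nonneg_of_hasLaw_expMeasure hexp] with a h0 h1 h2 h3 h4 hnn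
  rw [hxr] at h0
  -- `c0` turns the first alternative of the trichotomy into the desired bound; `c1` and `c2`
  -- contradict the other two for large `N`.
  have c0 := (h0.sub ((h3.mul_const r⁻¹).add (h4.mul_const s⁻¹))).eventually_const_lt
    (u := b) (by rw [← div_eq_mul_inv, ← div_eq_mul_inv]; linarith)
  have c1 := (h0.sub (h1.sub (h3.mul_const (1 / r₁ - 1 / r)))).eventually_const_lt
    (u := 0) (by rw [← hxr]; linarith)
  have c2 := (h0.sub (h2.sub (h4.mul_const (1 / s₂ - 1 / s)))).eventually_const_lt
    (u := 0) (by rw [← hxr]; linarith)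
  filter_upwards [c0, c1, c2, eventually_gt_atTop 0] with N d0 d1 d2 hN
  have hN0 : (0 : ℝ) < (N : ℝ)⁻¹ := inv_pos.2 (by exact_mod_cast hN)
  have hsr := one_div_le_one_div_of_le hr₁ hrr₁.le
  have hss := one_div_le_one_div_of_le hs₂ hss₂.le
  have tri := growth_trichotomy
    (h := fun i => stationaryField r s (fun x => ω x a) (.inl i))
    (v := fun j => stationaryField r s (fun x => ω x a) (.inr (.inl j)))
    (h₁ := fun i => stationaryField r₁ s₁ (fun x => ω x a) (.inl i))
    (v₁ := fun j => stationaryField r₁ s₁ (fun x => ω x a) (.inr (.inl j)))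
    (h₂ := fun i => stationaryField r₂ s₂ (fun x => ω x a) (.inl i))
    (v₂ := fun j => stationaryField r₂ s₂ (fun x => ω x a) (.inr (.inl j)))
    (w := fun i j => ω (i, j) a)
    (fun i => mul_nonneg (inv_nonneg.2 hr.le) (hnn _))
    (fun j => mul_nonneg (inv_nonneg.2 hs.le) (hnn _))
    (fun i => mul_le_mul_of_nonneg_right (by simpa using hsr) (hnn _))
    (fun j => mul_le_mul_of_nonneg_right (by simpa using hss) (hnn _))
    ⌊(N : ℝ) * ε⌋₊ ⌊(N : ℝ) * x⌋₊ ⌊(N : ℝ) * y⌋₊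
  simp only [stationaryField, ← sub_mul, ← Finset.mul_sum] at tri
  simp only [fieldGrowth, stationaryField] at d0 d1 d2
  rw [rectanglePassage]
  have hS : 0 ≤ ∑ i ∈ Finset.range ⌊(N : ℝ) * ε⌋₊, ω ((i : ℤ), -1) a :=
    Finset.sum_nonneg fun i _ => hnn _
  have hT : 0 ≤ ∑ i ∈ Finset.range ⌊(N : ℝ) * ε⌋₊, ω (-1, (i : ℤ)) a :=
    Finset.sum_nonneg fun i _ => hnn _
  rcases tri with H | H | H
  · have hmax := H.trans (add_le_add_left (max_le_add_of_nonneg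
      (mul_nonneg (inv_nonneg.2 hr.le) hS) (mul_nonneg (inv_nonneg.2 hs.le) hT)) _)
    have := mul_le_mul_of_nonneg_left hmax hN0.le
    simp only [mul_add] at this
    linarith
  · have := mul_le_mul_of_nonneg_left H hN0.le
    simp only [mul_sub, one_div] at this d1
    linarith
  · have := mul_le_mul_of_nonneg_left H hN0.le
    simp only [mul_sub, one_div] at this d2
    linarith

lemma ae_eventually_lt_rectanglePassage (hω : ∀ z, Measurable (ω z))
    (hindep : iIndepFun ω P) (hexp : ∀ x, HasLaw (ω x) (expMeasure 1) P) (hx : 0 ≤ x)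
    (hy : 0 ≤ y) (hb : b < (√x + √y) ^ 2) :
    ∀ᵐ a ∂P, ∀ᶠ N : ℕ in atTop, b < (N : ℝ)⁻¹ * rectanglePassage (fun x => ω x a)
      (⌊(N : ℝ) * x⌋₊ + 1) (⌊(N : ℝ) * y⌋₊ + 1) := by
  -- On an axis the optimal rate degenerates to `0` or `1`; the weights of a single column or row
  -- already suffice.
  rcases hx.eq_or_lt with rfl | hx'
  · rw [Real.sqrt_zero, zero_add, Real.sq_sqrt hy] at hb
    filter_upwards [tendsto_sum_line hω hindep hexp (g := fun i => ((0 : ℤ), (i : ℤ)))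
      (fun i j h => by simpa using h) (tendsto_inv_mul_floor_add_one hy),
      ae_nonneg_of_hasLaw_expMeasure hexp] with a ha hnn
    filter_upwards [ha.eventually_const_lt hb] with N hN
    refine hN.trans_le ?_
    gcongr
    exact sum_column_le_growth (w := fun i j => ω (i, j) a) (fun i j => hnn _) _ _
  rcases hy.eq_or_lt with rfl | hy'
  · rw [Real.sqrt_zero, add_zero, Real.sq_sqrt hx] at hb
    filter_upwards [tendsto_sum_line hω hindep hexp (g := fun i => ((i : ℤ), (0 : ℤ)))
      (fun i j h => by simpa using h) (tendsto_inv_mul_floor_add_one hx),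
      ae_nonneg_of_hasLaw_expMeasure hexp] with a ha hnn
    filter_upwards [ha.eventually_const_lt hb] with N hN
    refine hN.trans_le ?_
    gcongr
    exact sum_row_le_growth (w := fun i j => ω (i, j) a) (fun i j => hnn _) _ _
  exact ae_eventually_lt_rectanglePassage_of_pos hω hindep hexp hx' hy' hb

theorem tendsto_rectanglePassage (hω : ∀ z, Measurable (ω z)) (hindep : iIndepFun ω P)
    (hexp : ∀ x, HasLaw (ω x) (expMeasure 1) P) (hx : 0 ≤ x) (hy : 0 ≤ y) :
    ∀ᵐ a ∂P, Tendsto (fun N : ℕ => (N : ℝ)⁻¹ * rectanglePassage (fun x => ω x a)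
      (⌊(N : ℝ) * x⌋₊ + 1) (⌊(N : ℝ) * y⌋₊ + 1)) atTop (𝓝 ((√x + √y) ^ 2)) := by
  have up : ∀ᵐ a ∂P, ∀ b : ℚ, (√x + √y) ^ 2 < b → ∀ᶠ N : ℕ in atTop,
      (N : ℝ)⁻¹ * rectanglePassage (fun x => ω x a)
        (⌊(N : ℝ) * x⌋₊ + 1) (⌊(N : ℝ) * y⌋₊ + 1) < b := by
    rw [ae_all_iff]
    intro b
    by_cases hb : (√x + √y) ^ 2 < b
    · filter_upwards [ae_eventually_rectanglePassage_lt hω hindep hexp hx hy hb] with a ha _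
      exact ha
    · exact Eventually.of_forall fun a h => absurd h hb
  have lo : ∀ᵐ a ∂P, ∀ b : ℚ, b < (√x + √y) ^ 2 → ∀ᶠ N : ℕ in atTop,
      b < (N : ℝ)⁻¹ * rectanglePassage (fun x => ω x a)
        (⌊(N : ℝ) * x⌋₊ + 1) (⌊(N : ℝ) * y⌋₊ + 1) := by
    rw [ae_all_iff]
    intro b
    by_cases hb : b < (√x + √y) ^ 2
    · filter_upwards [ae_eventually_lt_rectanglePassage hω hindep hexp hx hy hb] with a ha _
      exact ha
    · exact Eventually.of_forall fun a h => absurd h hb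
  filter_upwards [up, lo] with a ha1 ha2
  rw [tendsto_order]
  constructor
  · intro c hc
    obtain ⟨b, hb1, hb2⟩ := exists_rat_btwn hc
    filter_upwards [ha2 b hb2] with N hN using hb1.trans hN
  · intro c hc
    obtain ⟨b, hb1, hb2⟩ := exists_rat_btwn hc
    filter_upwards [ha1 b hb1] with N hN using hN.trans hb2

end

/-! ### Paths and the recursion -/

section

variable {w : ℤ × ℤ → ℝ}

lemma latticeDist_zero_natCast (m n : ℕ) : latticeDist (0, 0) ((m : ℤ), (n : ℤ)) = m + n := by
  simp [latticeDist]

/-- There is an up-right path of length `d` from the origin to `z` with weight at least `t`. -/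
def HasPath (w : ℤ × ℤ → ℝ) (d : ℕ) (z : ℤ × ℤ) (t : ℝ) : Prop :=
  ∃ q : ℕ → ℤ × ℤ, q 0 = (0, 0) ∧ q d = z ∧
    (∀ k < d, q (k + 1) - q k = (1, 0) ∨ q (k + 1) - q k = (0, 1)) ∧
    t ≤ ∑ k ∈ Finset.range (d + 1), w (q k)

lemma HasPath.snoc {d : ℕ} {z z' : ℤ × ℤ} {t : ℝ} (h : HasPath w d z t)
    (hz : z' - z = (1, 0) ∨ z' - z = (0, 1)) : HasPath w (d + 1) z' (w z' + t) := by
  obtain ⟨q, h0, hd, hstep, ht⟩ := h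
  have hq : ∀ k ≤ d, (if k ≤ d then q k else z') = q k := fun k hk => if_pos hk
  have hq' : (if d + 1 ≤ d then q (d + 1) else z') = z' := if_neg (by omega)
  refine ⟨fun k => if k ≤ d then q k else z', ?_, hq', ?_, ?_⟩
  · simpa using h0
  · intro k hk
    rcases Nat.lt_succ_iff_lt_or_eq.1 hk with hk | rfl
    · dsimp only
      rw [hq k hk.le, hq (k + 1) hk]
      exact hstep k hk
    · dsimp only
      rw [hq k le_rfl, hq', hd]
      exact hz
  · rw [Finset.sum_range_succ, add_comm]
    simp only [hq']
    gcongr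
    refine ht.trans_eq (Finset.sum_congr rfl fun k hk => ?_)
    rw [hq k (Nat.lt_succ_iff.1 (Finset.mem_range.1 hk))]

lemma HasPath.mono {d : ℕ} {z : ℤ × ℤ} {t t' : ℝ} (h : HasPath w d z t) (ht : t' ≤ t) :
    HasPath w d z t' := by
  obtain ⟨q, h0, hd, hstep, hq⟩ := h
  exact ⟨q, h0, hd, hstep, ht.trans hq⟩

/-- Indices are shifted by one: row and column `0` of the recursion are a fictitious zero boundary.
Nonnegativity ensures that this boundary never beats a genuine predecessor. -/
lemma hasPath_rectanglePassage (hw : ∀ z, 0 ≤ w z) (m n : ℕ) :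
    HasPath w (m + n) ((m : ℤ), (n : ℤ)) (rectanglePassage w (m + 1) (n + 1)) := by
  have left : ∀ m n : ℕ, HasPath w (m + n) ((m : ℤ), (n : ℤ)) (rectanglePassage w (m + 1) (n + 1)) →
      HasPath w (m + 1 + n) (((m + 1 : ℕ) : ℤ), (n : ℤ))
        (w (((m + 1 : ℕ) : ℤ), (n : ℤ)) + rectanglePassage w (m + 1) (n + 1)) := by
    intro m n h
    rw [add_right_comm]
    exact h.snoc (Or.inl (by simp))
  have down : ∀ m n : ℕ, HasPath w (m + n) ((m : ℤ), (n : ℤ)) (rectanglePassage w (m + 1) (n + 1)) →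
      HasPath w (m + (n + 1)) ((m : ℤ), ((n + 1 : ℕ) : ℤ))
        (w ((m : ℤ), ((n + 1 : ℕ) : ℤ)) + rectanglePassage w (m + 1) (n + 1)) := by
    intro m n h
    exact h.snoc (Or.inr (by simp))
  have hnn : ∀ m n, 0 ≤ rectanglePassage w m n := growth_zero_nonneg fun i j => hw _
  have hm0 : ∀ m, rectanglePassage w m 0 = 0 := fun m => by
    simp [rectanglePassage, growth_zero_right]
  have h0n : ∀ n, rectanglePassage w 0 n = 0 := fun n => by
    simp [rectanglePassage, growth_zero_left]
  have succ : ∀ m n : ℕ, rectanglePassage w (m + 1) (n + 1) = w ((m : ℤ), (n : ℤ)) +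
      max (rectanglePassage w m (n + 1)) (rectanglePassage w (m + 1) n) := fun m n =>
    growth_succ _ _ _ m n
  induction m generalizing n with
  | zero =>
    induction n with
    | zero =>
      refine ⟨fun _ => (0, 0), rfl, by simp, by simp, ?_⟩
      rw [succ, hm0, h0n]
      simp
    | succ n ihn =>
      refine (down 0 n ihn).mono ?_
      rw [succ, h0n, max_eq_right (hnn _ _)]
  | succ m ihm =>
    induction n with
    | zero =>
      refine (left m 0 (ihm 0)).mono ?_
      rw [succ, hm0, max_eq_left (hnn _ _)]
    | succ n ihn =>
      rw [succ]
      rcases max_choice (rectanglePassage w (m + 1) (n + 1 + 1))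
        (rectanglePassage w (m + 1 + 1) (n + 1)) with e | e
      · rw [e]; exact left m (n + 1) (ihm (n + 1))
      · rw [e]; exact down (m + 1) n ihn

lemma sum_path_le_rectanglePassage {q : ℕ → ℤ × ℤ} {d : ℕ} (h0 : q 0 = (0, 0))
    (hstep : ∀ k < d, q (k + 1) - q k = (1, 0) ∨ q (k + 1) - q k = (0, 1)) :
    ∀ k ≤ d, ∃ i j : ℕ, q k = ((i : ℤ), (j : ℤ)) ∧
      ∑ l ∈ Finset.range (k + 1), w (q l) ≤ rectanglePassage w (i + 1) (j + 1) := by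
  intro k
  induction k with
  | zero =>
    intro _
    refine ⟨0, 0, h0, ?_⟩
    rw [rectanglePassage, growth_succ, growth_zero_left, growth_zero_right]
    simp [h0]
  | succ k ih =>
    intro hk
    obtain ⟨i, j, hij, hle⟩ := ih (by omega)
    rw [Finset.sum_range_succ, add_comm (∑ l ∈ _, _)]
    rcases hstep k (by omega) with h | h
    · have e : q (k + 1) = (((i + 1 : ℕ) : ℤ), (j : ℤ)) := by
        rw [sub_eq_iff_eq_add, hij] at h
        rw [h]; simp [add_comm]
      refine ⟨i + 1, j, e, ?_⟩
      rw [e]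
      exact (add_le_add_right hle _).trans
        (add_growth_left_le 0 0 (fun i j : ℕ => w (i, j)) (i + 1) j)
    · have e : q (k + 1) = ((i : ℤ), ((j + 1 : ℕ) : ℤ)) := by
        rw [sub_eq_iff_eq_add, hij] at h
        rw [h]; simp [add_comm]
      refine ⟨i, j + 1, e, ?_⟩
      rw [e]
      exact (add_le_add_right hle _).trans
        (add_growth_right_le 0 0 (fun i j : ℕ => w (i, j)) i (j + 1))

theorem lastPassage_eq_rectanglePassage (hw : ∀ z, 0 ≤ w z) (m n : ℕ) :
    lastPassage w (0, 0) ((m : ℤ), (n : ℤ)) = ((rectanglePassage w (m + 1) (n + 1) : ℝ) : EReal) := by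
  have hd := latticeDist_zero_natCast m n
  apply le_antisymm
  · refine iSup₂_le fun p hp => ?_
    obtain ⟨h0, hlast, hstep⟩ := hp
    let q : ℕ → ℤ × ℤ := fun k =>
      if h : k < latticeDist (0, 0) ((m : ℤ), (n : ℤ)) + 1 then p ⟨k, h⟩ else 0
    have hq : ∀ k (h : k < latticeDist (0, 0) ((m : ℤ), (n : ℤ)) + 1), q k = p ⟨k, h⟩ :=
      fun k h => dif_pos h
    obtain ⟨i, j, hij, hle⟩ := sum_path_le_rectanglePassage (w := w) (q := q)
      (d := latticeDist (0, 0) ((m : ℤ), (n : ℤ)))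
      (by rw [hq 0 (by omega)]; exact h0)
      (fun k hk => by
        rw [hq k (by omega), hq (k + 1) (by omega)]
        exact hstep ⟨k, hk⟩)
      _ le_rfl
    have hend : ((i : ℤ), (j : ℤ)) = ((m : ℤ), (n : ℤ)) := by
      rw [← hij, hq _ (by omega)]; exact hlast
    simp only [Prod.mk.injEq, Nat.cast_inj] at hend
    rw [hend.1, hend.2, ← Fin.sum_univ_eq_sum_range (fun k => w (q k))] at hle
    refine EReal.coe_le_coe_iff.2 (le_trans (le_of_eq ?_) hle)
    exact Finset.sum_congr rfl fun k _ => by rw [hq k k.2]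
  · obtain ⟨q, h0, hend, hstep, hle⟩ := hasPath_rectanglePassage hw m n
    rw [← hd] at hend hstep hle
    refine le_trans (EReal.coe_le_coe_iff.2 hle) ?_
    rw [← Fin.sum_univ_eq_sum_range (fun k => w (q k))]
    exact le_iSup₂_of_le (fun k => q k) ⟨h0, hend, fun k => hstep k k.2⟩ le_rfl

lemma floorPoint_smul {ξ : ℝ × ℝ} (h₁ : 0 ≤ ξ.1) (h₂ : 0 ≤ ξ.2) (N : ℕ) :
    floorPoint ((N : ℝ) • ξ) = ((⌊(N : ℝ) * ξ.1⌋₊ : ℤ), (⌊(N : ℝ) * ξ.2⌋₊ : ℤ)) := by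
  simp only [floorPoint, Prod.smul_fst, Prod.smul_snd, smul_eq_mul]
  rw [Int.natCast_floor_eq_floor (by positivity), Int.natCast_floor_eq_floor (by positivity)]

end

theorem mainTheorem4 {Ω : Type*} [MeasurableSpace Ω] (P : Measure Ω) [IsProbabilityMeasure P]
    (ω : ℤ × ℤ → Ω → ℝ)
    (hindep : iIndepFun ω P)
    (hexp : ∀ x : ℤ × ℤ, HasLaw (ω x) (expMeasure 1) P)
    (ξ : ℝ × ℝ) (hξ₁ : 0 ≤ ξ.1) (hξ₂ : 0 ≤ ξ.2) :
    ∀ᵐ a ∂P, Tendsto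
      (fun N : ℕ => (((N : ℝ)⁻¹ : ℝ) : EReal) *
        lastPassage (fun x => ω x a) (0, 0) (floorPoint ((N : ℝ) • ξ)))
      atTop (𝓝 (((√ξ.1 + √ξ.2) ^ 2 : ℝ) : EReal)) := by
  -- `HasLaw` gives only a.e. measurability. The lattice is countable, so the measurable versions
  -- agree with `ω` at all sites off one null set.
  have hae : ∀ x, ω x =ᵐ[P] (hexp x).aemeasurable.mk (ω x) := fun x =>
    (hexp x).aemeasurable.ae_eq_mk
  have hlaw : ∀ x, HasLaw ((hexp x).aemeasurable.mk (ω x)) (expMeasure 1) P := fun x =>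
    (hexp x).congr (hae x).symm
  filter_upwards [tendsto_rectanglePassage (fun x => (hexp x).aemeasurable.measurable_mk)
    ((iIndepFun_congr hae).1 hindep) hlaw hξ₁ hξ₂, ae_nonneg_of_hasLaw_expMeasure hlaw,
    ae_all_iff.2 hae] with a ha hnn heq
  refine ((continuous_coe_real_ereal.tendsto _).comp ha).congr fun N => ?_
  rw [floorPoint_smul hξ₁ hξ₂, lastPassage_eq_rectanglePassage fun z => by
    rw [heq z]; exact hnn z]
  simp only [heq, Function.comp, EReal.coe_mul]
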